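/- Let $N$ be a finite set of players with $\#N \ge 2$ and let $1 \le K \le \#N$. Let $\mathcal P(K)$ be the set of all partitions $P$ of $N$ into nonempty coalitions of size at most $K$ (coalition structures). A coalition-structure formation game $\Gamma(K)$ with maximum coalition size $K$ consists of the following data. (a) For every player $i$ and every $P \in \mathcal P(K)$, a finite set $S_i(P)$ of strategies of $i$ for $P$. The strategy set of $i$ is $S_i(K) = \bigcup_{P \in \mathcal P(K)} S_i(P)$, which is nonempty, and the set of strategy profiles is $S(K) = \prod_{i \in N} S_i(K)$. (b) A coalition-structure formation mechanism $\mathcal R(K)$, which assigns to every profile $s \in S(K)$ exactly one coalition structure in $\mathcal P(K)$. It thus divides $S(K)$ into disjoint domains, $S(K) = \bigsqcup_{P \in \mathcal P(K)} S(P)$, where $S(P)$ is the set of the profiles to which $P$ is assigned. (c) For every player $i$ and every $P \in \mathcal P(K)$, a payoff function $U_i(P) \colon S(P) \to \mathbb R$. A mixed strategy of player $i$ is a probability distribution $\sigma_i$ on $S_i(K)$, and the expected utility of $i$ at a profile of mixed strategies $\sigma = (\sigma_j)_{j \in N}$ is $$EU_i(\sigma) = \sum_{P \in \mathcal P(K)}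 \ \sum_{s \in S(P)} U_i(P)(s) \prod_{j \in N} \sigma_j(s_j).$$ A profile of mixed strategies $\sigma^*$ is an equilibrium of $\Gamma(K)$ if for every set of players $n \subseteq N$ with $1 \le \# n \le K$, every player $i \in n$ and every mixed strategy $\sigma_i \ne \sigma^*_i$ of $i$, $$EU_i(\sigma^*_i, \sigma^*_{-i}) \ \ge\ EU_i(\sigma_i, \sigma^*_{-i}).$$ **Theorem.** Every such game $\Gamma(K)$ has an equilibrium in mixed strategies. -/

import Mathlib

universe u v

/-- The family `𝒫(K)` of coalition structures with maximum coalition size `K`: partitions of the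
set of all players into nonempty, pairwise disjoint coalitions, each with at most `K` members. -/
abbrev CoalitionStructure (N : Type u) [Fintype N] [DecidableEq N] (K : ℕ) : Type u :=
  {P : Finpartition (Finset.univ : Finset N) // ∀ g ∈ P.parts, g.card ≤ K}

/-- A simultaneous coalition structure formation game `Γ(K)` on the set of players `N`, with
maximum coalition size `K`. -/
structure CoalitionGame (N : Type u) [Fintype N] [DecidableEq N] (K : ℕ) where
  /-- An ambient type for the strategies of player `i`. -/
  Action : N → Type v
  /-- The finite set `S_i(P)` of strategies of player `i` for the coalition structure `P`. -/
  strat : (i : N) → CoalitionStructure N K → Finset (Action i)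
  /-- Every player has at least one strategy. -/
  exists_strat : ∀ i, ∃ P, (strat i P).Nonempty
  /-- The coalition structure formation mechanism `ℛ(K)`: it assigns one realized coalition
  structure to every profile of `S(K) = ∏ i, S_i(K)`, where `S_i(K) = ⋃ P, S_i(P)`. -/
  mechanism : ((i : N) → {a : Action i // ∃ P, a ∈ strat i P}) → CoalitionStructure N K
  /-- The coalition structure specific payoff `U_i(P) : S(P) → ℝ` of player `i`, where `S(P)` is
  the set of all profiles to which the mechanism assigns `P`. -/
  payoff : (i : N) → (P : CoalitionStructure N K) →
    {s : (i : N) → {a : Action i // ∃ P, a ∈ strat i P} // mechanism s = P} → ℝ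

namespace CoalitionGame

variable {N : Type u} [Fintype N] [DecidableEq N] {K : ℕ} (G : CoalitionGame.{u, v} N K)

/-- The strategy set `S_i(K) = ⋃ P ∈ 𝒫(K), S_i(P)` of player `i`. -/
abbrev Strategy (i : N) : Type v := {a : G.Action i // ∃ P, a ∈ G.strat i P}

/-- The set of strategy profiles `S(K) = ∏ i, S_i(K)`. -/
abbrev Profile : Type (max u v) := (i : N) → G.Strategy i

/-- The strategy domain `S(P)` of the coalition structure `P`: the profiles at which `P` forms. -/
abbrev Domain (P : CoalitionStructure N K) : Type (max u v) :=
  {s : G.Profile // G.mechanism s = P}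

instance finite_strategy (i : N) : Finite (G.Strategy i) := by
  have h : (⋃ P : CoalitionStructure N K, (G.strat i P : Set (G.Action i))).Finite :=
    Set.finite_iUnion fun P => (G.strat i P).finite_toSet
  refine Set.Finite.to_subtype (s := {a | ∃ P, a ∈ G.strat i P}) (h.subset ?_)
  rintro a ⟨P, hP⟩
  exact Set.mem_iUnion.2 ⟨P, hP⟩

noncomputable instance fintypeStrategy (i : N) : Fintype (G.Strategy i) := Fintype.ofFinite _

noncomputable instance fintypeDomain (P : CoalitionStructure N K) : Fintype (G.Domain P) :=
  Fintype.ofFinite _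

/-- The mixed strategies `Δ_i(K)` of player `i`: the probability distributions on `S_i(K)`. -/
abbrev MixedStrategy (i : N) : Type v := stdSimplex ℝ (G.Strategy i)

/-- A mixed strategy profile: one mixed strategy for every player. -/
abbrev MixedProfile : Type (max u v) := (i : N) → G.MixedStrategy i

/-- The probability of the pure profile `s` when the players randomize independently. -/
noncomputable def profileProb (σ : G.MixedProfile) (s : G.Profile) : ℝ :=
  ∏ j, (σ j).1 (s j)

/-- The expected utility of player `i`, summed over the realized coalition structures `P` and over
the strategy domain `S(P)` of each of them. -/
noncomputable def expectedUtility (σ : G.MixedProfile) (i : N) : ℝ :=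
  ∑ P : CoalitionStructure N K, ∑ s : G.Domain P, G.payoff i P s * G.profileProb σ s.1

/-- `σ` is an equilibrium in mixed strategies: for every set `n` of players with `1 ≤ #n ≤ K` and
every player `i ∈ n`, no deviation of `i` to another mixed strategy `τ`, the mixed strategies of
all the other players being unchanged, gives `i` a higher expected utility. -/
def IsEquilibrium (σ : G.MixedProfile) : Prop :=
  ∀ n : Finset N, 1 ≤ n.card → n.card ≤ K → ∀ i ∈ n, ∀ τ : G.MixedStrategy i, τ ≠ σ i →
    G.expectedUtility (Function.update σ i τ) i ≤ G.expectedUtility σ i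

end CoalitionGame

/-! An equilibrium condition here concerns deviations of one player at a time, so a Nash equilibrium
on the strategy sets S_i(K) suffices. The domains S(P) partition S(K), hence expected utility is a
finite sum of products of probabilities: continuous, and linear in each player's own mixed strategy
(`expectedUtility_update_eq_sum`). Nash's theorem (`exists_nash_equilibrium`) then applies.

Nash's theorem follows from Brouwer on a product of simplices, applied to the map that shifts weight
towards profitable pure strategies. The product is a retract of one large simplex, up to scaling. On
a simplex, Brouwer comes from a parity argument (`exists_dominating_image_eq_univ`) in the role of
Sperner's lemma: the coordinates order the grid points, and a dominating set with all labels is a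
cluster of nearby points that yields an approximate fixed point. -/

/-! ### Scarf's lemma: dominating sets and parity. -/

section Scarf

open Finset

variable {X I α : Type*} [LinearOrder α]

/-- Every point lies weakly below all of `B` in at least one of the orders given by `key`. -/
def Dominating (key : I → X → α) (B : Finset X) : Prop :=
  ∀ y, ∃ i, ∀ b ∈ B, key i y ≤ key i b

lemma Dominating.mono {key : I → X → α} {B D : Finset X} (hB : Dominating key B) (h : D ⊆ B) :
    Dominating key D := fun y => (hB y).imp fun _ hi b hb => hi b (h hb)

/-- A set with as many points as colours has an odd number of points whose removal leaves exactly
the colours other than `i₀` if and only if all colours occur. -/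
lemma odd_card_erase_image_eq_iff [DecidableEq X] [Fintype I] [DecidableEq I] (c : X → I) (i₀ : I) (B : Finset X)
    (hB : B.card = Fintype.card I) :
    Odd (B.filter fun x => (B.erase x).image c = univ.erase i₀).card ↔ B.image c = univ := by
  have hcard0 : 0 < Fintype.card I := Fintype.card_pos_iff.2 ⟨i₀⟩
  constructor
  · intro hodd
    -- If `i₀` is missing and some deletion leaves all other colours, exactly one colour is
    -- repeated, by two points `x` and `y`. Precisely these two can be deleted, so the count is
    -- even.
    by_contra hne
    obtain ⟨x, hx⟩ := Finset.card_pos.1 hodd.pos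
    rw [mem_filter] at hx
    obtain ⟨hxB, hx⟩ := hx
    have hcx : c x ≠ i₀ := by
      intro h
      apply hne
      rw [← insert_erase hxB, image_insert, hx, h, insert_erase (mem_univ _)]
    have hinj : Set.InjOn c (B.erase x : Finset X) := by
      rw [← card_image_iff, hx, card_erase_of_mem hxB, card_erase_of_mem (mem_univ _), hB, card_univ]
    have hmem : c x ∈ (B.erase x).image c := by rw [hx]; simp [hcx]
    obtain ⟨y, hy, hyx⟩ := mem_image.1 hmem
    have hyB := mem_of_mem_erase hy
    have hne' : y ≠ x := ne_of_mem_erase hy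
    have : (B.filter fun x => (B.erase x).image c = univ.erase i₀) = {x, y} := by
      ext z
      simp only [mem_filter, mem_insert, mem_singleton]
      constructor
      · rintro ⟨hzB, hz⟩
        by_contra! hzz
        have hcz : c z ∈ univ.erase i₀ := by
          rw [← hx]; exact mem_image_of_mem _ (mem_erase.2 ⟨hzz.1, hzB⟩)
        rw [← hz] at hcz
        obtain ⟨w, hw, hwz⟩ := mem_image.1 hcz
        have hwB := mem_of_mem_erase hw
        by_cases hwx : w = x
        · subst hwx
          exact hzz.2 (hinj (mem_erase.2 ⟨hzz.1, hzB⟩) hy (by rw [hyx, hwz]))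
        · exact ne_of_mem_erase hw
            (hinj (mem_erase.2 ⟨hwx, hwB⟩) (mem_erase.2 ⟨hzz.1, hzB⟩) hwz)
      · rintro (rfl | rfl)
        · exact ⟨hxB, hx⟩
        · refine ⟨hyB, ?_⟩
          rw [← hx]
          ext k
          simp only [mem_image, mem_erase]
          constructor
          · rintro ⟨w, ⟨hw, hwB⟩, rfl⟩
            by_cases hwx : w = x
            · exact ⟨z, ⟨hne', hyB⟩, by rw [hwx, hyx]⟩
            · exact ⟨w, ⟨hwx, hwB⟩, rfl⟩
          · rintro ⟨w, ⟨hw, hwB⟩, rfl⟩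
            by_cases hwx : w = z
            · exact ⟨x, ⟨hne'.symm, hxB⟩, by rw [hwx, hyx]⟩
            · exact ⟨w, ⟨hwx, hwB⟩, rfl⟩
    rw [this, card_pair hne'.symm] at hodd
    exact absurd hodd (by decide)
  · intro himg
    have hinj : Set.InjOn c B := by
      rw [← card_image_iff, himg, hB, card_univ]
    obtain ⟨x, hxB, hx⟩ := mem_image.1 (himg ▸ mem_univ i₀)
    have : (B.filter fun x => (B.erase x).image c = univ.erase i₀) = {x} := by
      ext z
      simp only [mem_filter, mem_singleton]
      constructor
      · rintro ⟨hzB, hz⟩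
        by_contra hzx
        have : c x ∈ (B.erase z).image c :=
          mem_image_of_mem _ (mem_erase.2 ⟨fun h => hzx h.symm, hxB⟩)
        rw [hz, hx] at this
        simp at this
      · rintro rfl
        refine ⟨hxB, ?_⟩
        ext k
        simp only [mem_image, mem_erase, mem_univ, and_true]
        constructor
        · rintro ⟨w, ⟨hw, hwB⟩, rfl⟩ h
          exact hw (hinj hwB hxB (h.trans hx.symm))
        · intro hk
          obtain ⟨w, hwB, rfl⟩ := mem_image.1 (himg ▸ mem_univ k)
          exact ⟨w, ⟨fun h => hk (by rw [h, hx]), hwB⟩, rfl⟩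
    rw [this]; simp

open Classical in
/-- A dominating set with one point fewer than there are orders has exactly two dominating
one-point extensions, provided that every order `i` has a point outside the set that is above the
set in all the other orders. -/
lemma card_dominating_insert_eq_two [Fintype X] [Fintype I] {key : I → X → α} (hkey : ∀ i, Function.Injective (key i))
    {D : Finset X} (hD : Dominating key D) (hcard : D.card + 1 = Fintype.card I)
    (hne : D.Nonempty)
    (htop : ∀ i, ∃ x, ∀ k, k ≠ i → ∃ b ∈ D, key k b < key k x) :
    (univ.filter fun x => x ∉ D ∧ Dominating key (insert x D)).card = 2 := by
  have hm : ∀ i, ∃ b ∈ D, ∀ b' ∈ D, key i b ≤ key i b' := fun i =>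
    exists_min_image D (key i) hne
  choose m hmD hmin using hm
  -- Domination at a member of `D` makes that member a minimum of `D` in some order. There is one
  -- more order than points, so some point is the minimum in two orders.
  have hsurj : univ.image m = D := by
    ext y
    simp only [mem_image, mem_univ, true_and]
    refine ⟨fun ⟨i, hi⟩ => hi ▸ hmD i, fun hy => ?_⟩
    obtain ⟨i, hi⟩ := hD y
    exact ⟨i, hkey i (le_antisymm (hmin i y hy) (hi _ (hmD i)))⟩
  obtain ⟨i₁, i₂, h12, hm12⟩ : ∃ i₁ i₂, i₁ ≠ i₂ ∧ m i₁ = m i₂ := by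
    by_contra! h
    have : (univ.image m).card = Fintype.card I := by
      rw [card_image_of_injective _ fun a b hab => by_contra fun hne => h a b hne hab, card_univ]
    rw [hsurj] at this
    omega
  -- an extension point is the minimum of the extended set in the order `i₁` or `i₂`
  have hext : ∀ x, x ∉ D → Dominating key (insert x D) →
      ∃ i, (i = i₁ ∨ i = i₂) ∧ ∀ k, k ≠ i → key k (m k) < key k x := by
    intro x hx hdom
    have hm' : ∀ i, ∃ b ∈ insert x D, ∀ b' ∈ insert x D, key i b ≤ key i b' := fun i =>
      exists_min_image _ (key i) (insert_nonempty _ _)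
    choose m' hmD' hmin' using hm'
    have hsurj' : univ.image m' = insert x D := by
      ext y
      simp only [mem_image, mem_univ, true_and]
      refine ⟨fun ⟨i, hi⟩ => hi ▸ hmD' i, fun hy => ?_⟩
      obtain ⟨i, hi⟩ := hdom y
      exact ⟨i, hkey i (le_antisymm (hmin' i y hy) (hi _ (hmD' i)))⟩
    have hinj' : Function.Injective m' := by
      have : Set.InjOn m' (univ : Finset I) := by
        rw [← card_image_iff, hsurj', card_insert_of_notMem hx, hcard, card_univ]
      simpa using this
    have hcase : ∀ i, m' i ≠ x → m' i = m i := fun i hi => by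
      have hmem := (mem_insert.1 (hmD' i)).resolve_left hi
      exact hkey i (le_antisymm (hmin' i _ (mem_insert_of_mem (hmD i))) (hmin i _ hmem))
    obtain ⟨i, -, hi⟩ := mem_image.1 (hsurj' ▸ mem_insert_self x D : x ∈ univ.image m')
    have hlt : ∀ k, k ≠ i → key k (m k) < key k x := fun k hk => by
      have hkx : m' k ≠ x := fun h => hk (hinj' (h.trans hi.symm))
      rw [← hcase k hkx]
      exact lt_of_le_of_ne (hmin' k x (mem_insert_self _ _)) fun h => hkx (hkey k h)
    refine ⟨i, ?_, hlt⟩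
    by_contra! hii
    have e1 : m' i₁ = m i₁ := hcase _ fun h => hii.1 (hinj' (hi.trans h.symm))
    have e2 : m' i₂ = m i₂ := hcase _ fun h => hii.2 (hinj' (hi.trans h.symm))
    exact h12 (hinj' (by rw [e1, e2, hm12]))
  have huniq : ∀ i, (i = i₁ ∨ i = i₂) → ∃ x, x ∉ D ∧ Dominating key (insert x D) ∧
      (∀ k, k ≠ i → key k (m k) < key k x) ∧
      ∀ y, y ∉ D → Dominating key (insert y D) → (∀ k, k ≠ i → key k (m k) < key k y) → y = x := by
    intro i hi
    obtain ⟨j, hji, hmj⟩ : ∃ j, j ≠ i ∧ m j = m i := by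
      rcases hi with rfl | rfl
      · exact ⟨i₂, h12.symm, hm12.symm⟩
      · exact ⟨i₁, h12, hm12⟩
    obtain ⟨x₀, hx₀⟩ := htop i
    -- `M` collects the points above the minima of `D` in every order but `i`. Domination by `D`
    -- keeps them below `m i` in order `i`, and the highest of them there is the extension.
    let M := univ.filter fun x => ∀ k, k ≠ i → key k (m k) < key k x
    have hM : M.Nonempty := ⟨x₀, mem_filter.2 ⟨mem_univ _, fun k hk => by
      obtain ⟨b, hb, hlt⟩ := hx₀ k hk
      exact (hmin k b hb).trans_lt hlt⟩⟩
    obtain ⟨x, hxM, hxmax⟩ := exists_max_image M (key i) hM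
    have hx := (mem_filter.1 hxM).2
    have hle : ∀ y ∈ M, key i y ≤ key i (m i) := fun y hy => by
      obtain ⟨k, hk⟩ := hD y
      have : k = i := by
        by_contra hki
        exact absurd (hk _ (hmD k)) ((mem_filter.1 hy).2 k hki).not_ge
      exact this ▸ hk _ (hmD k)
    have hnot : ∀ y ∈ M, y ∉ D := fun y hy hyD => by
      have h1 : y = m i := hkey i (le_antisymm (hle y hy) (hmin i y hyD))
      have h2 := (mem_filter.1 hy).2 j hji
      rw [hmj, h1] at h2
      exact lt_irrefl _ h2
    have hdomx : Dominating key (insert x D) := by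
      intro y
      by_cases hyM : y ∈ M
      · refine ⟨i, fun b hb => ?_⟩
        rcases mem_insert.1 hb with rfl | hb
        · exact hxmax y hyM
        · exact (hle y hyM).trans (hmin i b hb)
      · have : ∃ k, k ≠ i ∧ key k y ≤ key k (m k) := by
          by_contra! h
          exact hyM (mem_filter.2 ⟨mem_univ _, h⟩)
        obtain ⟨k, hki, hk⟩ := this
        refine ⟨k, fun b hb => ?_⟩
        rcases mem_insert.1 hb with rfl | hb
        · exact hk.trans (hx k hki).le
        · exact hk.trans (hmin k b hb)
    refine ⟨x, hnot x hxM, hdomx, hx, fun y hyD hydom hy => ?_⟩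
    have hyM : y ∈ M := mem_filter.2 ⟨mem_univ _, hy⟩
    refine hkey i (le_antisymm (hxmax y hyM) ?_)
    obtain ⟨k, hk⟩ := hydom x
    have : k = i := by
      by_contra hki
      exact absurd (hk _ (mem_insert_of_mem (hmD k))) (hx k hki).not_ge
    exact this ▸ hk y (mem_insert_self _ _)
  obtain ⟨x₁, hx₁, hd₁, hl₁, hu₁⟩ := huniq i₁ (Or.inl rfl)
  obtain ⟨x₂, hx₂, hd₂, hl₂, hu₂⟩ := huniq i₂ (Or.inr rfl)
  -- A common extension would lie above the minima of `D` in every order, against domination.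
  have hx12 : x₁ ≠ x₂ := by
    rintro rfl
    obtain ⟨k, hk⟩ := hD x₁
    by_cases hk1 : k = i₁
    · exact absurd (hk _ (hmD k)) (hl₂ k (hk1 ▸ h12)).not_ge
    · exact absurd (hk _ (hmD k)) (hl₁ k hk1).not_ge
  rw [card_eq_two]
  refine ⟨x₁, x₂, hx12, ?_⟩
  ext y
  simp only [mem_filter, mem_univ, true_and, mem_insert, mem_singleton]
  constructor
  · rintro ⟨hy, hdom⟩
    obtain ⟨i, rfl | rfl, hi⟩ := hext y hy hdom
    · exact Or.inl (hu₁ y hy hdom hi)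
    · exact Or.inr (hu₂ y hy hdom hi)
  · rintro (rfl | rfl)
    · exact ⟨hx₁, hd₁⟩
    · exact ⟨hx₂, hd₂⟩

/-- A form of Scarf's lemma: there is a dominating set that carries all colours. -/
theorem exists_dominating_image_eq_univ [Fintype X] [Fintype I] [DecidableEq I] {key : I → X → α} (hkey : ∀ i, Function.Injective (key i))
    (slack : I → X) (hbot : ∀ i y, y ≠ slack i → key i (slack i) < key i y)
    (htop : ∀ i j y, j ≠ i → y ∉ Set.range slack → key i y < key i (slack j))
    (hX : ∃ y, y ∉ Set.range slack) (c : X → I) (hc : ∀ i, c (slack i) = i) [Nonempty I] :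
    ∃ B : Finset X, B.image c = univ ∧ Dominating key B := by
  classical
  obtain ⟨i₀⟩ := ‹Nonempty I›
  have hslack : Function.Injective slack := fun i j h => by rw [← hc i, h, hc]
  -- Pairs of a set in `R` and a facet of it in `E` are counted twice over. Each facet in `E` has
  -- two extensions, except `D₀` with one, so the total is odd and some set in `R` has an odd number
  -- of such facets.
  let R : Finset (Finset X) :=
    univ.filter fun B => B.card = Fintype.card I ∧ Dominating key B
  let E : Finset (Finset X) :=
    univ.filter fun D => D.card + 1 = Fintype.card I ∧ Dominating key D ∧
      D.image c = univ.erase i₀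
  let D₀ : Finset X := (univ.erase i₀).image slack
  have hcardI : 0 < Fintype.card I := Fintype.card_pos_iff.2 ⟨i₀⟩
  obtain ⟨t, ht⟩ := hX
  have hD₀card : D₀.card + 1 = Fintype.card I := by
    rw [card_image_of_injective _ hslack, card_erase_of_mem (mem_univ _), card_univ]; omega
  have hD₀mem : ∀ b, b ∈ D₀ ↔ ∃ i, i ≠ i₀ ∧ slack i = b := by simp [D₀]
  have hD₀ : D₀ ∈ E := by
    refine mem_filter.2 ⟨mem_univ _, hD₀card, fun y => ?_, ?_⟩
    · by_cases hy : y ∈ Set.range slack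
      · obtain ⟨i, rfl⟩ := hy
        refine ⟨i, fun b _ => ?_⟩
        by_cases hb : b = slack i
        · rw [hb]
        · exact (hbot i b hb).le
      · refine ⟨i₀, fun b hb => ?_⟩
        obtain ⟨i, hi, rfl⟩ := (hD₀mem b).1 hb
        exact (htop i₀ i y hi hy).le
    · rw [image_image, show c ∘ slack = id from funext hc, image_id]
  -- the exceptional facet has exactly one extension
  have hdeg₀ : (univ.filter fun x => x ∉ D₀ ∧ Dominating key (insert x D₀)).card = 1 := by
    obtain ⟨x, hx, hxmax⟩ := exists_max_image (univ.filter fun y => y ∉ Set.range slack) (key i₀)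
      ⟨t, mem_filter.2 ⟨mem_univ _, ht⟩⟩
    have hx := (mem_filter.1 hx).2
    rw [card_eq_one]
    refine ⟨x, ?_⟩
    ext y
    simp only [mem_filter, mem_univ, true_and, mem_singleton]
    have key_lt : ∀ z k, z ∉ Set.range slack → k ≠ i₀ → key k (slack k) < key k z :=
      fun z k hz _ => hbot k z fun h => hz ⟨k, h.symm⟩
    constructor
    · rintro ⟨hy, hdom⟩
      obtain ⟨k, hk⟩ := hdom x
      have hki : k = i₀ := by
        by_contra hki
        exact absurd (hk _ (mem_insert_of_mem ((hD₀mem _).2 ⟨k, hki, rfl⟩)))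
          (key_lt x k hx hki).not_ge
      subst hki
      have hyr : y ∉ Set.range slack := by
        rintro ⟨j, rfl⟩
        have hj : j = k := by
          by_contra hj
          exact hy ((hD₀mem _).2 ⟨j, hj, rfl⟩)
        subst hj
        exact absurd (hk _ (mem_insert_self _ _)) (hbot j x fun h => hx ⟨j, h.symm⟩).not_ge
      exact hkey k (le_antisymm (hxmax y (mem_filter.2 ⟨mem_univ _, hyr⟩))
        (hk y (mem_insert_self _ _)))
    · rintro rfl
      refine ⟨fun h => ?_, fun z => ?_⟩
      · obtain ⟨i, -, hi⟩ := (hD₀mem _).1 h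
        exact hx ⟨i, hi⟩
      · by_cases hz : z ∈ Set.range slack
        · obtain ⟨i, rfl⟩ := hz
          refine ⟨i, fun b _ => ?_⟩
          by_cases hb : b = slack i
          · rw [hb]
          · exact (hbot i b hb).le
        · refine ⟨i₀, fun b hb => ?_⟩
          rcases mem_insert.1 hb with rfl | hb
          · exact hxmax z (mem_filter.2 ⟨mem_univ _, hz⟩)
          · obtain ⟨i, hi, rfl⟩ := (hD₀mem b).1 hb
            exact (htop i₀ i z hi hz).le
  have hdeg : ∀ D ∈ E, D ≠ D₀ →
      (univ.filter fun x => x ∉ D ∧ Dominating key (insert x D)).card = 2 := by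
    intro D hDE hne
    obtain ⟨-, hcard, hdom, himg⟩ := mem_filter.1 hDE
    -- Slack points alone, with these colours and this cardinality, would form `D₀`. Given a
    -- non-slack `d`, the point `slack i` exceeds it in every order but `i`, as the two-extension
    -- lemma requires.
    have : ∃ d ∈ D, d ∉ Set.range slack := by
      by_contra! h
      refine hne (eq_of_subset_of_card_le (fun d hd => ?_) (by omega))
      obtain ⟨i, rfl⟩ := h d hd
      have := mem_image_of_mem c hd
      rw [himg, hc] at this
      exact (hD₀mem _).2 ⟨i, ne_of_mem_erase this, rfl⟩
    obtain ⟨d, hd, hdr⟩ := this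
    exact card_dominating_insert_eq_two hkey hdom hcard ⟨d, hd⟩ fun i =>
      ⟨slack i, fun k hk => ⟨d, hd, htop k i d hk.symm hdr⟩⟩
  have hbij : ∑ B ∈ R, (B.filter fun x => (B.erase x).image c = univ.erase i₀).card =
      ∑ D ∈ E, (univ.filter fun x => x ∉ D ∧ Dominating key (insert x D)).card := by
    rw [← card_sigma, ← card_sigma]
    refine card_bij' (fun p _ => ⟨p.1.erase p.2, p.2⟩) (fun p _ => ⟨insert p.2 p.1, p.2⟩)
      ?_ ?_ ?_ ?_
    · rintro ⟨B, x⟩ h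
      simp only [mem_sigma, mem_filter, mem_univ, true_and, R, E] at h ⊢
      obtain ⟨⟨h1, h2⟩, h3, h4⟩ := h
      refine ⟨⟨?_, h2.mono (erase_subset _ _), h4⟩, notMem_erase _ _, ?_⟩
      · rw [card_erase_of_mem h3]; omega
      · rwa [insert_erase h3]
    · rintro ⟨D, x⟩ h
      simp only [mem_sigma, mem_filter, mem_univ, true_and, R, E] at h ⊢
      obtain ⟨⟨h1, h2, h3⟩, h4, h5⟩ := h
      refine ⟨⟨?_, h5⟩, mem_insert_self _ _, ?_⟩
      · rw [card_insert_of_notMem h4, h1]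
      · rwa [erase_insert h4]
    · rintro ⟨B, x⟩ h
      simp only [mem_sigma, mem_filter] at h
      simp [insert_erase h.2.1]
    · rintro ⟨D, x⟩ h
      simp only [mem_sigma, mem_filter] at h
      simp [erase_insert h.2.2.1]
  have hodd : Odd (∑ D ∈ E, (univ.filter fun x => x ∉ D ∧ Dominating key (insert x D)).card) := by
    rw [← add_sum_erase E _ hD₀, hdeg₀, sum_congr rfl fun D hD =>
      hdeg D (mem_of_mem_erase hD) (ne_of_mem_erase hD), sum_const, smul_eq_mul]
    exact ⟨_, by rw [add_comm, mul_comm]⟩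
  rw [← hbij] at hodd
  have : ∃ B ∈ R, Odd (B.filter fun x => (B.erase x).image c = univ.erase i₀).card := by
    by_contra! h
    exact Nat.not_even_iff_odd.2 hodd
      (even_sum _ fun B hB => Nat.not_odd_iff_even.1 (h B hB))
  obtain ⟨B, hB, hBodd⟩ := this
  obtain ⟨-, h1, h2⟩ := mem_filter.1 hB
  exact ⟨B, (odd_card_erase_image_eq_iff c i₀ B h1).1 hBodd, h2⟩

end Scarf

/-! ### Brouwer's theorem on a simplex, by labelled grids. -/

section Brouwer

open Finset

/-- Points of the grid of mesh `1 / n` on a simplex: for every labelling there is a grid point `x`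
which, for every label `i`, is near a grid point of label `i` or near the face `x i = 0`. -/
lemma exists_grid_point_near_labels {I : Type*} [Fintype I] [Nonempty I] [DecidableEq I] (n : ℕ)
    (c : (I → ℕ) → I) :
    ∃ x : I → ℕ, ∑ i, x i = n ∧ ∀ i, x i ≤ Fintype.card I ∨ ∃ y : I → ℕ, ∑ i, y i = n ∧ c y = i ∧
      ∀ j, y j ≤ x j + Fintype.card I ∧ x j ≤ y j + Fintype.card I := by
  classical
  let T := {x : I → ℕ // x ∈ piAntidiag univ n}
  have hT : ∀ x : T, ∑ i, x.1 i = n := fun x => by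
    have := x.2; rw [mem_piAntidiag] at this; exact this.1
  have mkT : ∀ x : I → ℕ, ∑ i, x i = n → x ∈ piAntidiag univ n := fun x hx => by
    rw [mem_piAntidiag]; exact ⟨hx, fun i _ => mem_univ i⟩
  have hTle : ∀ (x : T) i, x.1 i ≤ n := fun x i =>
    (single_le_sum (f := x.1) (fun _ _ => Nat.zero_le _) (mem_univ i)).trans_eq (hT x)
  have : Fintype T := inferInstanceAs (Fintype (piAntidiag univ n : Finset (I → ℕ)))
  let e := Fintype.equivFin (T ⊕ I)
  -- Shifted coordinates lie between 1 and `n + 1`, so 0 puts a slack point at the bottom of its own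
  -- order and `n + 2` at the top of the others.
  let a : I → T ⊕ I → ℕ := fun i =>
    Sum.elim (fun x => x.1 i + 1) fun j => if j = i then 0 else n + 2
  -- The enumeration `e` breaks ties, which makes every order injective.
  let key : I → T ⊕ I → ℕ ×ₗ Fin (Fintype.card (T ⊕ I)) := fun i z => toLex (a i z, e z)
  have key_lt : ∀ i z w, a i z < a i w → key i z < key i w := fun i z w h =>
    Prod.Lex.toLex_lt_toLex.2 (Or.inl h)
  have le_of_key_le : ∀ i z w, key i z ≤ key i w → a i z ≤ a i w := fun i z w h => by
    by_contra! h'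
    exact absurd h (key_lt i w z h').not_ge
  have hkey : ∀ i, Function.Injective (key i) := fun i z w h => by
    have := congrArg (fun p => (ofLex p).2) h
    exact e.injective this
  obtain ⟨i₁⟩ := ‹Nonempty I›
  have t₀ : T := ⟨Pi.single i₁ n, mkT _ (by simp)⟩
  obtain ⟨B, himg, hdom⟩ := exists_dominating_image_eq_univ hkey (fun i => (Sum.inr i : T ⊕ I))
    (by
      rintro i (x | j) h
      · exact key_lt _ _ _ (by simp [a])
      · have : j ≠ i := fun hj => h (by rw [hj])
        exact key_lt _ _ _ (by simp [a, this]))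
    (by
      rintro i j (x | k) hji h
      · have := hTle x i
        exact key_lt _ _ _ (by simp [a, hji]; omega)
      · exact absurd ⟨k, rfl⟩ h)
    ⟨Sum.inl t₀, by simp⟩ (Sum.elim (fun x => c x.1) id) (fun _ => rfl)
  let J : Finset I := univ.filter fun i => Sum.inr i ∉ B
  have hJ : ∀ i ∈ J, ∃ s : T, Sum.inl s ∈ B ∧ c s.1 = i := by
    intro i hi
    have hi := (mem_filter.1 hi).2
    obtain ⟨b, hb, hbi⟩ := mem_image.1 (himg ▸ mem_univ i)
    rcases b with s | j
    · exact ⟨s, hb, hbi⟩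
    · have hj : j = i := hbi
      exact absurd (hj ▸ hb) hi
  -- An order whose slack point is in `B` cannot witness domination of a grid point, since that
  -- slack point has value 0.
  have hdomT : ∀ t : T, ∃ i ∈ J, ∀ s : T, Sum.inl s ∈ B → t.1 i ≤ s.1 i := by
    intro t
    obtain ⟨i, hi⟩ := hdom (Sum.inl t)
    refine ⟨i, mem_filter.2 ⟨mem_univ _, fun h => ?_⟩, fun s hs => ?_⟩
    · have := le_of_key_le _ _ _ (hi _ h)
      simp [a] at this
    · have := le_of_key_le _ _ _ (hi _ hs)
      simpa [a] using this
  obtain ⟨i₀, hi₀, -⟩ := hdomT t₀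
  obtain ⟨s₀, hs₀, -⟩ := hJ i₀ hi₀
  have hmin : ∀ i, ∃ s : T, Sum.inl s ∈ B ∧ ∀ s' : T, Sum.inl s' ∈ B → s.1 i ≤ s'.1 i := by
    intro i
    obtain ⟨s, hs, h⟩ := exists_min_image (univ.filter fun s : T => Sum.inl s ∈ B)
      (fun s => s.1 i) ⟨s₀, by simpa using hs₀⟩
    exact ⟨s, by simpa using hs, fun s' hs' => h s' (by simpa using hs')⟩
  choose m hmB hm using hmin
  -- Otherwise a grid point could exceed all the minima over `J`, any leftover being put on `i₀`,
  -- against domination. So the minima over `J` fall short of `n` by less than `J.card`, which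
  -- confines all grid points of `B` to a small cluster.
  have hsum : n < ∑ i ∈ J, ((m i).1 i + 1) := by
    by_contra! h
    let t : I → ℕ := fun i => (if i ∈ J then (m i).1 i + 1 else 0) +
      if i = i₀ then n - ∑ i ∈ J, ((m i).1 i + 1) else 0
    have ht : ∑ i, t i = n := by
      simp only [t, sum_add_distrib, sum_ite_mem, univ_inter, sum_ite_eq', mem_univ, if_true]
      simp only [sum_add_distrib] at h ⊢
      omega
    obtain ⟨i, hi, hle⟩ := hdomT ⟨t, mkT t ht⟩
    have := hle _ (hmB i)
    simp only [t, hi, if_true] at this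
    omega
  have hJcard : J.card ≤ Fintype.card I := card_le_univ J
  rw [sum_add_distrib, sum_const, smul_eq_mul, mul_one] at hsum
  have hsplit : ∀ s : T, ∑ i ∈ J, s.1 i + ∑ i ∈ univ \ J, s.1 i = n := fun s => by
    rw [add_comm, sum_sdiff (subset_univ J), hT]
  have hmem : ∀ s : T, Sum.inl s ∈ B → ∀ i ∈ J,
      (m i).1 i ≤ s.1 i ∧ s.1 i ≤ (m i).1 i + Fintype.card I := by
    intro s hs i hi
    refine ⟨hm i s hs, ?_⟩
    have h1 := hsplit s
    rw [← add_sum_erase J _ hi] at h1 hsum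
    have h2 : ∑ k ∈ J.erase i, (m k).1 k ≤ ∑ k ∈ J.erase i, s.1 k :=
      sum_le_sum fun k _ => hm k s hs
    omega
  have hnot : ∀ s : T, Sum.inl s ∈ B → ∀ i, i ∉ J → s.1 i ≤ Fintype.card I := by
    intro s hs i hi
    have h1 := hsplit s
    have h2 : ∑ k ∈ J, (m k).1 k ≤ ∑ k ∈ J, s.1 k := sum_le_sum fun k _ => hm k s hs
    have h3 : s.1 i ≤ ∑ i ∈ univ \ J, s.1 i :=
      single_le_sum (f := s.1) (fun _ _ => Nat.zero_le _) (by simp [hi])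
    omega
  refine ⟨s₀.1, hT s₀, fun i => ?_⟩
  by_cases hi : i ∈ J
  · obtain ⟨s, hs, hsi⟩ := hJ i hi
    refine Or.inr ⟨s.1, hT s, hsi, fun j => ?_⟩
    by_cases hj : j ∈ J
    · have h1 := hmem s hs j hj
      have h2 := hmem s₀ hs₀ j hj
      omega
    · have h1 := hnot s hs j hj
      have h2 := hnot s₀ hs₀ j hj
      omega
  · exact Or.inl (hnot s₀ hs₀ i hi)

/-- **Brouwer's fixed point theorem** for the standard simplex. -/
theorem stdSimplex.exists_fixedPoint {I : Type*} [Fintype I] [Nonempty I]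
    (f : stdSimplex ℝ I → stdSimplex ℝ I) (hf : Continuous f) : ∃ x, f x = x := by
  classical
  -- The label is a coordinate that `f` does not decrease; one exists as both coordinate sums are 1.
  have hlabel : ∀ x : stdSimplex ℝ I, ∃ i, x i ≤ f x i := by
    intro x
    by_contra! h
    have := sum_lt_sum_of_nonempty (s := univ) univ_nonempty fun i _ => h i
    rw [stdSimplex.sum_eq_one, stdSimplex.sum_eq_one] at this
    exact lt_irrefl _ this
  -- Near a point `y` of label `i`, the bound costs ε/2 for moving from `x` to `y` and ε/2 for
  -- moving from `f y` to `f x`. Near the face `x i = 0` it holds because `f x i` is nonnegative.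
  have happrox : ∀ ε > 0, ∃ x : stdSimplex ℝ I, ∀ i, x i - f x i ≤ ε := by
    intro ε hε
    have huc := CompactSpace.uniformContinuous_of_continuous hf
    obtain ⟨δ, hδ, hδf⟩ := Metric.uniformContinuous_iff.1 huc (ε / 2) (by linarith)
    obtain ⟨n, hn⟩ := exists_nat_gt ((Fintype.card I : ℝ) / min δ (ε / 2))
    have hmin : 0 < min δ (ε / 2) := lt_min hδ (by linarith)
    have hn0 : (0 : ℝ) < n := lt_of_le_of_lt (by positivity) hn
    have hd : (Fintype.card I : ℝ) / n < min δ (ε / 2) := by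
      rw [div_lt_iff₀ hmin] at hn
      rw [div_lt_iff₀ hn0]
      linarith
    let p : ∀ x : I → ℕ, ∑ i, x i = n → stdSimplex ℝ I := fun x hx =>
      ⟨fun i => (x i : ℝ) / n, fun i => by positivity, by
        rw [← sum_div, ← Nat.cast_sum, hx, div_self hn0.ne']⟩
    have hp : ∀ x hx i, p x hx i = (x i : ℝ) / n := fun _ _ _ => rfl
    choose l hl using hlabel
    obtain ⟨x, hx, hxi⟩ := exists_grid_point_near_labels n fun x =>
      if hx : ∑ i, x i = n then l (p x hx) else Classical.arbitrary I
    refine ⟨p x hx, fun i => ?_⟩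
    have hdε := hd.trans_le (min_le_right _ _)
    rcases hxi i with h | ⟨y, hy, hyi, hxy⟩
    · have h0 : 0 ≤ f (p x hx) i := stdSimplex.zero_le _ _
      have : p x hx i ≤ Fintype.card I / n := by
        rw [hp x hx]
        exact div_le_div_of_nonneg_right (by exact_mod_cast h) hn0.le
      linarith
    · rw [dif_pos hy] at hyi
      have hdist : dist (p x hx) (p y hy) ≤ Fintype.card I / n := by
        rw [Subtype.dist_eq, dist_pi_le_iff (by positivity)]
        intro j
        change |(x j : ℝ) / n - (y j : ℝ) / n| ≤ _
        rw [← sub_div, abs_div, abs_of_pos hn0]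
        gcongr
        have h1 : (y j : ℝ) ≤ x j + Fintype.card I := by exact_mod_cast (hxy j).1
        have h2 : (x j : ℝ) ≤ y j + Fintype.card I := by exact_mod_cast (hxy j).2
        rw [abs_le]; constructor <;> linarith
      have hcoord : ∀ u w : stdSimplex ℝ I, |u i - w i| ≤ dist u w := fun u w =>
        dist_le_pi_dist u.1 w.1 i
      have h1 := hl (p y hy)
      rw [hyi] at h1
      have h2 := abs_le.1 ((hcoord _ _).trans hdist)
      have h3 := abs_le.1 ((hcoord _ _).trans
        (hδf (hdist.trans_lt (hd.trans_le (min_le_left _ _)))).le)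
      linarith
  have hcoe : ∀ i, Continuous fun x : stdSimplex ℝ I => x i := fun i =>
    (continuous_apply i).comp continuous_subtype_val
  -- One-sided bounds suffice: a minimiser of the largest `x i - f x i` has all these differences
  -- nonpositive, and they sum to 0.
  have hg : Continuous fun x : stdSimplex ℝ I =>
      univ.sup' univ_nonempty fun i => x i - f x i :=
    Continuous.finset_sup'_apply _ fun i _ => (hcoe i).sub ((hcoe i).comp hf)
  obtain ⟨x, -, hx⟩ := isCompact_univ.exists_isMinOn Set.univ_nonempty hg.continuousOn
  have hle : ∀ i, x i - f x i ≤ 0 := by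
    refine fun i => le_of_forall_pos_le_add fun ε hε => ?_
    obtain ⟨y, hy⟩ := happrox ε hε
    rw [zero_add]
    exact (le_sup' (fun i => x i - f x i) (mem_univ i)).trans
      ((hx (Set.mem_univ y)).trans (sup'_le _ _ fun j _ => hy j))
  refine ⟨x, stdSimplex.ext (funext fun i => ?_)⟩
  have hsum : ∑ i, (f x i - x i) = 0 := by
    rw [sum_sub_distrib, stdSimplex.sum_eq_one, stdSimplex.sum_eq_one, sub_self]
  have := (sum_eq_zero_iff_of_nonneg fun i _ => by linarith [hle i]).1 hsum i (mem_univ i)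
  linarith

end Brouwer

/-! ### Brouwer on products of simplices and Nash's theorem. -/

section Nash

open Finset

variable {N : Type u} [Fintype N] [Nonempty N] {A : N → Type v} [∀ i, Fintype (A i)]
  [∀ i, Nonempty (A i)]

lemma stdSimplex.continuous_coe_apply {I : Type*} [Fintype I] (a : I) :
    Continuous fun x : stdSimplex ℝ I => x a :=
  (continuous_apply a).comp continuous_subtype_val

lemma stdSimplex.continuous_mk {Y I : Type*} [TopologicalSpace Y] [Fintype I]
    {g : Y → stdSimplex ℝ I} (h : ∀ a, Continuous fun y => g y a) : Continuous g :=
  continuous_induced_rng.2 (continuous_pi h)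

/-- **Brouwer's fixed point theorem** for a product of standard simplices. -/
theorem stdSimplex.exists_fixedPoint_pi
    (f : (∀ i, stdSimplex ℝ (A i)) → ∀ i, stdSimplex ℝ (A i)) (hf : Continuous f) :
    ∃ x, f x = x := by
  have hN : (0 : ℝ) < Fintype.card N := by exact_mod_cast Fintype.card_pos
  have hA : ∀ i, (0 : ℝ) < Fintype.card (A i) := fun i => by exact_mod_cast Fintype.card_pos
  let z : stdSimplex ℝ (Σ i, A i) → ∀ i, A i → ℝ := fun x i a => Fintype.card N * x ⟨i, a⟩
  let S : stdSimplex ℝ (Σ i, A i) → N → ℝ := fun x i => ∑ a, z x i a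
  have hpos : ∀ x i, 0 < max (S x i) 1 := fun x i => lt_max_of_lt_right one_pos
  have hz0 : ∀ x i a, 0 ≤ z x i a := fun x i a => mul_nonneg hN.le (stdSimplex.zero_le _ _)
  -- a retraction of the simplex on all pairs onto the product of the simplices
  let r : stdSimplex ℝ (Σ i, A i) → ∀ i, stdSimplex ℝ (A i) := fun x i =>
    -- Missing mass in a block is spread uniformly and excess mass is scaled away; the maximum with
    -- 1 keeps the denominator positive.
    ⟨fun a => (z x i a + max (1 - S x i) 0 / Fintype.card (A i)) / max (S x i) 1,
      fun a => div_nonneg (add_nonneg (hz0 x i a)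
        (div_nonneg (le_max_right _ _) (hA i).le)) (hpos x i).le, by
      rw [← sum_div, sum_add_distrib, sum_const, card_univ, nsmul_eq_mul,
        mul_div_cancel₀ _ (hA i).ne', div_eq_one_iff_eq (hpos x i).ne']
      change S x i + _ = _
      rcases le_total (S x i) 1 with h | h
      · rw [max_eq_left (by linarith), max_eq_right h]; ring
      · rw [max_eq_right (by linarith), max_eq_left h]; ring⟩
  have hzc : ∀ i a, Continuous fun x => z x i a := fun i a =>
    continuous_const.mul (stdSimplex.continuous_coe_apply _)
  have hSc : ∀ i, Continuous fun x => S x i := fun i =>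
    continuous_finsetSum _ fun a _ => hzc i a
  have hr : Continuous r := continuous_pi fun i => stdSimplex.continuous_mk fun a =>
    Continuous.div ((hzc i a).add (((continuous_const.sub (hSc i)).max continuous_const).div_const _))
      ((hSc i).max continuous_const) fun x => (hpos x i).ne'
  -- Each block of `F x` has weight 1 / #N, so at a fixed point the rescaled blocks sum to 1, and
  -- there `r` only rescales.
  let F : stdSimplex ℝ (Σ i, A i) → stdSimplex ℝ (Σ i, A i) := fun x =>
    ⟨fun p => f (r x) p.1 p.2 / Fintype.card N,
      fun p => div_nonneg (stdSimplex.zero_le _ _) hN.le, by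
      rw [← sum_div, Fintype.sum_sigma, div_eq_one_iff_eq hN.ne']
      exact (sum_congr rfl fun i _ => stdSimplex.sum_eq_one (f (r x) i)).trans (by simp)⟩
  have hF : Continuous F := stdSimplex.continuous_mk fun p =>
    ((stdSimplex.continuous_coe_apply p.2).comp
      ((continuous_apply p.1).comp (hf.comp hr))).div_const _
  have : Nonempty (Σ i, A i) := ⟨⟨Classical.arbitrary N, Classical.arbitrary _⟩⟩
  obtain ⟨x, hx⟩ := stdSimplex.exists_fixedPoint F hF
  have hzx : ∀ i a, z x i a = f (r x) i a := fun i a => by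
    have : F x ⟨i, a⟩ = x ⟨i, a⟩ := by rw [hx]
    change Fintype.card N * x ⟨i, a⟩ = _
    rw [← this]
    exact mul_div_cancel₀ _ hN.ne'
  have hS : ∀ i, S x i = 1 := fun i => by
    simp only [S, hzx, stdSimplex.sum_eq_one]
  refine ⟨r x, funext fun i => stdSimplex.ext (funext fun a => ?_)⟩
  rw [← hzx]
  change _ = (z x i a + max (1 - S x i) 0 / Fintype.card (A i)) / max (S x i) 1
  simp [hS]

open Classical in
/-- **Nash's theorem**, for continuous utilities that are affine in the own mixed strategy. -/
theorem exists_nash_equilibrium (V : (∀ i, stdSimplex ℝ (A i)) → N → ℝ)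
    (hV : ∀ i, Continuous fun σ => V σ i)
    (haff : ∀ σ i τ, V (Function.update σ i τ) i =
      ∑ a, τ a * V (Function.update σ i (stdSimplex.vertex a)) i) :
    ∃ σ, ∀ i τ, V (Function.update σ i τ) i ≤ V σ i := by
  let W : (∀ i, stdSimplex ℝ (A i)) → ∀ i, A i → ℝ := fun σ i a =>
    V (Function.update σ i (stdSimplex.vertex a)) i
  let g : (∀ i, stdSimplex ℝ (A i)) → ∀ i, A i → ℝ := fun σ i a => max (W σ i a - V σ i) 0
  have hg0 : ∀ σ i a, 0 ≤ g σ i a := fun σ i a => le_max_right _ _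
  have hden : ∀ σ i, 0 < 1 + ∑ a, g σ i a := fun σ i =>
    add_pos_of_pos_of_nonneg one_pos (sum_nonneg fun a _ => hg0 σ i a)
  let f : (∀ i, stdSimplex ℝ (A i)) → ∀ i, stdSimplex ℝ (A i) := fun σ i =>
    ⟨fun a => (σ i a + g σ i a) / (1 + ∑ b, g σ i b),
      fun a => div_nonneg (add_nonneg (stdSimplex.zero_le _ _) (hg0 σ i a)) (hden σ i).le, by
      rw [← sum_div, sum_add_distrib, stdSimplex.sum_eq_one, div_self (hden σ i).ne']⟩
  have hgc : ∀ i a, Continuous fun σ => g σ i a := fun i a =>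
    (((hV i).comp (continuous_id.update i continuous_const)).sub (hV i)).max continuous_const
  have hf : Continuous f := continuous_pi fun i => stdSimplex.continuous_mk fun a =>
    Continuous.div (((stdSimplex.continuous_coe_apply a).comp (continuous_apply i)).add (hgc i a))
      (continuous_const.add (continuous_finsetSum _ fun b _ => hgc i b)) fun σ => (hden σ i).ne'
  obtain ⟨σ, hσ⟩ := stdSimplex.exists_fixedPoint_pi f hf
  have hmean : ∀ i, ∑ a, σ i a * W σ i a = V σ i := fun i => by
    rw [← haff σ i (σ i), Function.update_eq_self]
  have hle : ∀ i a, W σ i a ≤ V σ i := by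
    intro i a
    -- `V σ i` is the `σ i`-average of the pure payoffs, so some `b` in the support does no better
    -- than average. Its gain vanishes, and the fixed-point equation at `b` then forces the total
    -- gain to be 0.
    obtain ⟨b, hb, hWb⟩ : ∃ b, 0 < σ i b ∧ W σ i b ≤ V σ i := by
      by_contra! h
      have h1 : ∀ b, σ i b * V σ i ≤ σ i b * W σ i b := fun b => by
        rcases (stdSimplex.zero_le (σ i) b).eq_or_lt with h0 | h0
        · rw [← h0, zero_mul, zero_mul]
        · exact mul_le_mul_of_nonneg_left (h b h0).le h0.le
      obtain ⟨b, hb⟩ : ∃ b, 0 < σ i b := by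
        by_contra! h0
        have := sum_nonpos (s := univ) fun b _ => h0 b
        rw [stdSimplex.sum_eq_one] at this
        linarith
      have := sum_lt_sum (s := univ) (fun b _ => h1 b)
        ⟨b, mem_univ b, mul_lt_mul_of_pos_left (h b hb) hb⟩
      rw [hmean, ← sum_mul, stdSimplex.sum_eq_one, one_mul] at this
      exact lt_irrefl _ this
    have hgb : g σ i b = 0 := max_eq_right (by linarith)
    have hfix : (σ i b + g σ i b) / (1 + ∑ b, g σ i b) = σ i b := by
      change f σ i b = σ i b
      rw [hσ]
    rw [hgb, add_zero, div_eq_iff (hden σ i).ne', mul_add, mul_one, left_eq_add,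
      mul_eq_zero, or_iff_right hb.ne', sum_eq_zero_iff_of_nonneg fun a _ => hg0 σ i a] at hfix
    have h1 := hfix a (mem_univ a)
    have h2 : W σ i a - V σ i ≤ g σ i a := le_max_left _ _
    linarith
  refine ⟨σ, fun i τ => ?_⟩
  rw [haff]
  calc ∑ a, τ a * W σ i a ≤ ∑ a, τ a * V σ i :=
        sum_le_sum fun a _ => mul_le_mul_of_nonneg_left (hle i a) (stdSimplex.zero_le _ _)
    _ = V σ i := by rw [← sum_mul, stdSimplex.sum_eq_one, one_mul]

end Nash

/-! ### Expected utility is continuous and linear in one's own mixed strategy. -/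

namespace CoalitionGame

variable {N : Type u} [Fintype N] [DecidableEq N] {K : ℕ} (G : CoalitionGame.{u, v} N K)

lemma nonempty_strategy (i : N) : Nonempty (G.Strategy i) := by
  obtain ⟨P, a, ha⟩ := G.exists_strat i
  exact ⟨⟨a, P, ha⟩⟩

lemma profileProb_update (σ : G.MixedProfile) (i : N) (τ : G.MixedStrategy i) (s : G.Profile) :
    G.profileProb (Function.update σ i τ) s = τ (s i) * ∏ j ∈ Finset.univ.erase i, σ j (s j) := by
  rw [profileProb, ← Finset.mul_prod_erase _ _ (Finset.mem_univ i), Function.update_self]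
  congr 1
  refine Finset.prod_congr rfl fun j hj => ?_
  rw [Function.update_of_ne (Finset.ne_of_mem_erase hj)]
  rfl

-- Only one factor of the product involves player `i`, and a vertex contributes to it only when it
-- is the pure strategy `s i`.
open Classical in
lemma profileProb_update_eq_sum (σ : G.MixedProfile) (i : N) (τ : G.MixedStrategy i)
    (s : G.Profile) : G.profileProb (Function.update σ i τ) s =
      ∑ a, τ a * G.profileProb (Function.update σ i (stdSimplex.vertex a)) s := by
  simp only [profileProb_update, ← mul_assoc, ← Finset.sum_mul]
  congr 1
  rw [Finset.sum_eq_single (s i)]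
  · simp
  · intro a _ ha
    simp [ha]
  · simp

open Classical in
lemma expectedUtility_update_eq_sum (σ : G.MixedProfile) (i : N) (τ : G.MixedStrategy i) :
    G.expectedUtility (Function.update σ i τ) i =
      ∑ a, τ a * G.expectedUtility (Function.update σ i (stdSimplex.vertex a)) i := by
  simp only [expectedUtility, Finset.mul_sum]
  rw [Finset.sum_comm]
  refine Finset.sum_congr rfl fun P _ => ?_
  rw [Finset.sum_comm]
  refine Finset.sum_congr rfl fun s _ => ?_
  rw [profileProb_update_eq_sum, Finset.mul_sum]
  exact Finset.sum_congr rfl fun a _ => mul_left_comm _ _ _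

lemma continuous_expectedUtility (i : N) :
    Continuous fun σ : G.MixedProfile => G.expectedUtility σ i :=
  continuous_finsetSum _ fun _ _ => continuous_finsetSum _ fun s _ => continuous_const.mul <|
    continuous_finsetProd _ fun j _ =>
      (stdSimplex.continuous_coe_apply (s.1 j)).comp (continuous_apply j)

end CoalitionGame

theorem theorem1 {N : Type u} [Fintype N] [DecidableEq N] (hN : 2 ≤ Fintype.card N)
    (K : ℕ) (hK : 1 ≤ K) (hKN : K ≤ Fintype.card N) (G : CoalitionGame.{u, v} N K) :
    ∃ σ : G.MixedProfile, G.IsEquilibrium σ := by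
  have : Nonempty N := Fintype.card_pos_iff.1 (by omega)
  have := G.nonempty_strategy
  obtain ⟨σ, hσ⟩ := exists_nash_equilibrium G.expectedUtility G.continuous_expectedUtility
    fun σ i τ => by convert G.expectedUtility_update_eq_sum σ i τ
  refine ⟨σ, fun n _ _ i _ τ _ => ?_⟩
  convert hσ i τ
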